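/- For $m\ge 1$ and a function $\phi:\mathbb{R}\to\mathbb{R}$, let $\mathcal{S}_m(\phi)$ be the set of all functions $F:\mathbb{R}^m\to\mathbb{R}$ expressed by a shallow $\phi$-network, that is, of the form $$F(x)=\sum_{i=1}^{k}t_i\,\phi(\langle y_i,x\rangle+\varrho_i),\qquad k\in\mathbb{N},\ y_i\in\mathbb{R}^m,\ t_i,\varrho_i\in\mathbb{R}.$$ For a measurable set $\Omega\subset\mathbb{R}^m$, let $L^p(\Omega)$ be the space of real-valued $L^p$ functions on $\Omega$ with respect to Lebesgue measure, with its norm topology, and let $\mathcal{S}_m(\phi)\cap L^p(\Omega)$ be the set of (classes of) those functions in $\mathcal{S}_m(\phi)$ whose restriction to $\Omega$ belongs to $L^p(\Omega)$. **Theorem.** Let $n\in\mathbb{N}$, $2\le p<\infty$ and $\Omega=\mathbb{R}\times[0,1]^n\subset\mathbb{R}^{n+1}$. If a function $\phi:\mathbb{R}\to\mathbb{R}$ satisfies $\overline{\mathcal{S}_1(\phi)\cap L^p(\mathbb{R})}=L^p(\mathbb{R})$, then $\overline{\mathcal{S}_{n+1}(\phi)\cap L^p(\Omega)}=L^p(\Omega)$.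 -/

import Mathlib

open MeasureTheory
open scoped ENNReal

/-- The space `𝒮(φ)` of functions on a Euclidean space `E` (such as `ℝ` or `ℝᵐ`) that are expressed
by a shallow `φ`-network: finite sums `x ↦ ∑ i, t i * φ (⟪y i, x⟫ + ρ i)`, for an arbitrary
activation function `φ : ℝ → ℝ`. -/
def shallowNetworks (E : Type*) [NormedAddCommGroup E] [InnerProductSpace ℝ E] (φ : ℝ → ℝ) :
    Set (E → ℝ) :=
  {F | ∃ (k : ℕ) (y : Fin k → E) (t ρ : Fin k → ℝ),
    F = fun x => ∑ i, t i * φ (inner ℝ (y i) x + ρ i)}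

/-- `𝒮(φ) ∩ Lᵖ(Ω)`: the classes in the real space `Lᵖ(Ω)` (with respect to Lebesgue measure on `Ω`)
of those functions expressed by shallow `φ`-networks whose restriction to `Ω` is
`Lᵖ`-integrable. -/
def shallowNetworksInLp {E : Type*} [NormedAddCommGroup E] [InnerProductSpace ℝ E]
    [MeasureSpace E] (φ : ℝ → ℝ) (p : ℝ≥0∞) (Ω : Set E) :
    Set (Lp ℝ p (volume.restrict Ω : Measure E)) :=
  {f | ∃ F ∈ shallowNetworks E φ, ∃ hF : MemLp F p (volume.restrict Ω), f = hF.toLp F}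

/-- Shallow `φ`-networks are a universal approximator in `Lᵖ(Ω)`: the closure of `𝒮(φ) ∩ Lᵖ(Ω)` in
the normed space `Lᵖ(Ω)` is all of `Lᵖ(Ω)`. -/
def IsUniversalApproximator {E : Type*} [NormedAddCommGroup E] [InnerProductSpace ℝ E]
    [MeasureSpace E] (φ : ℝ → ℝ) (p : ℝ≥0∞) [Fact (1 ≤ p)] (Ω : Set E) : Prop :=
  closure (shallowNetworksInLp φ p Ω) = Set.univ

/-- The strip `ℝ × [0,1]ⁿ` in `ℝⁿ⁺¹`: the coordinate with index `0` is free, the others lie in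
`[0,1]`. -/
def strip (n : ℕ) : Set (EuclideanSpace ℝ (Fin (n + 1))) :=
  {x | ∀ i : Fin n, x i.succ ∈ Set.Icc (0 : ℝ) 1}

/-! Differentiating a ridge function `x ↦ z ⟪a, x⟫` with respect to its direction `a`, along `b`,
produces `x ↦ ⟪b, x⟫ * z' ⟪a, x⟫`. For `p > 1` the derivatives of test functions are dense in
`Lᵖ(ℝ)`: the integral is not a bounded functional there, since the dilations `t ↦ c * h (c * t)`
keep it fixed but tend to `0` in `Lᵖ`. Hence the closed span of the ridge functions with profile in
`Lᵖ(ℝ)` is stable under multiplication by `⟪b, ·⟫` whenever this is bounded on the domain, that is,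
for `b` orthogonal to the axis of the strip. Together with the continuous functions of the remaining
coordinate these multipliers separate points, so Stone–Weierstrass makes the span dense. Finally, a
ridge function with profile in `Lᵖ(ℝ)` and direction not orthogonal to the axis is a limit of
networks, because composition with `⟪a, ·⟫` is bounded from `Lᵖ(ℝ)` to `Lᵖ` of the strip. -/

theorem exists_pos_forall_eLpNorm_le {α F : Type*} [MeasurableSpace α] [NormedAddCommGroup F]
    {p : ℝ≥0∞} {μ : Measure α} {s : Set α} (hs : MeasurableSet s) (hμs : μ s ≠ ∞) (hp0 : p ≠ 0)
    (hp' : p ≠ ∞) {ε : ℝ≥0∞} (hε : ε ≠ 0) :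
    ∃ η > 0, ∀ f : α → F, (∀ᵐ x ∂μ, ‖f x‖ ≤ s.indicator (fun _ => η) x) →
      eLpNorm f p μ ≤ ε := by
  have hμs' : μ s ^ (1 / p.toReal) ≠ ∞ := ENNReal.rpow_ne_top_of_nonneg (by positivity) hμs
  obtain ⟨η, hη, hηε⟩ := ENNReal.exists_nnreal_pos_mul_lt hμs' hε
  refine ⟨η, hη, fun f hf => ?_⟩
  calc eLpNorm f p μ ≤ eLpNorm (s.indicator fun _ => (η : ℝ)) p μ := eLpNorm_mono_ae_real hf
    _ = η * μ s ^ (1 / p.toReal) := by rw [eLpNorm_indicator_const hs hp0 hp']; simp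
    _ ≤ ε := hηε.le

section LpClosure

variable {α β F G : Type*} [MeasurableSpace α] [MeasurableSpace β]
  [NormedAddCommGroup F] [NormedSpace ℝ F] [NormedAddCommGroup G] [NormedSpace ℝ G]
  {p : ℝ≥0∞} {μ : Measure α} {ν : Measure β}

/-- A linear map between spaces of functions that induces a bounded operator
`Lᵖ(μ) → Lᵖ(ν)`. -/
def IsLpBounded (p : ℝ≥0∞) (μ : Measure α) (ν : Measure β) (T : (α → F) →ₗ[ℝ] (β → G)) : Prop :=
  ∃ K : ℝ≥0∞, K ≠ ∞ ∧ ∀ f, MemLp f p μ →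
    AEStronglyMeasurable (T f) ν ∧ eLpNorm (T f) p ν ≤ K * eLpNorm f p μ

theorem IsLpBounded.memLp {T : (α → F) →ₗ[ℝ] (β → G)} (hT : IsLpBounded p μ ν T) {f : α → F}
    (hf : MemLp f p μ) : MemLp (T f) p ν := by
  obtain ⟨K, hK, hTK⟩ := hT
  exact ⟨(hTK f hf).1, (hTK f hf).2.trans_lt (ENNReal.mul_lt_top hK.lt_top hf.2)⟩

theorem IsLpBounded.comp {γ H : Type*} [MeasurableSpace γ] [NormedAddCommGroup H]
    [NormedSpace ℝ H] {ξ : Measure γ} {T : (α → F) →ₗ[ℝ] (β → G)} {U : (β → G) →ₗ[ℝ] (γ → H)}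
    (hU : IsLpBounded p ν ξ U) (hT : IsLpBounded p μ ν T) : IsLpBounded p μ ξ (U ∘ₗ T) := by
  obtain ⟨K, hK, hTK⟩ := id hT
  obtain ⟨L, hL, hUL⟩ := hU
  refine ⟨L * K, ENNReal.mul_ne_top hL hK, fun f hf => ⟨(hUL _ (hT.memLp hf)).1, ?_⟩⟩
  calc eLpNorm (U (T f)) p ξ ≤ L * eLpNorm (T f) p ν := (hUL _ (hT.memLp hf)).2
    _ ≤ L * (K * eLpNorm f p μ) := by gcongr; exact (hTK f hf).2
    _ = L * K * eLpNorm f p μ := (mul_assoc _ _ _).symm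

theorem IsLpBounded.id : IsLpBounded p μ μ (LinearMap.id : (α → F) →ₗ[ℝ] (α → F)) :=
  ⟨1, ENNReal.one_ne_top, fun _ hf => ⟨hf.1, by simp⟩⟩

theorem isLpBounded_mulLeft {v : α → ℝ} (hv : AEStronglyMeasurable v μ) {C : ℝ}
    (hC : ∀ᵐ x ∂μ, |v x| ≤ C) : IsLpBounded p μ μ (LinearMap.mulLeft ℝ v) := by
  refine ⟨ENNReal.ofReal C, ENNReal.ofReal_ne_top, fun f hf => ⟨hv.mul hf.1, ?_⟩⟩
  refine eLpNorm_le_mul_eLpNorm_of_ae_le_mul (hC.mono fun x hx => ?_) p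
  rw [LinearMap.mulLeft_apply, Pi.mul_apply, norm_mul, Real.norm_eq_abs]
  gcongr

variable [Fact (1 ≤ p)]

/-- The closure of `S ∩ Lᵖ(μ)` in `Lᵖ(μ)`, as a space of functions rather than of classes: all
`f ∈ Lᵖ(μ)` that are limits in the `Lᵖ` norm of elements of `S` that lie in `Lᵖ(μ)`. -/
def lpClosure (p : ℝ≥0∞) [Fact (1 ≤ p)] (μ : Measure α) (S : Submodule ℝ (α → F)) :
    Submodule ℝ (α → F) where
  carrier := {f | MemLp f p μ ∧ ∀ ε ≠ 0, ∃ g ∈ S, MemLp g p μ ∧ eLpNorm (f - g) p μ ≤ ε}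
  zero_mem' := ⟨MemLp.zero, fun ε _ => ⟨0, S.zero_mem, MemLp.zero, by simp⟩⟩
  add_mem' := by
    rintro f₁ f₂ ⟨hf₁, h₁⟩ ⟨hf₂, h₂⟩
    refine ⟨hf₁.add hf₂, fun ε hε => ?_⟩
    obtain ⟨g₁, hg₁S, hg₁, hfg₁⟩ := h₁ (ε / 2) (ENNReal.half_pos hε).ne'
    obtain ⟨g₂, hg₂S, hg₂, hfg₂⟩ := h₂ (ε / 2) (ENNReal.half_pos hε).ne'
    refine ⟨g₁ + g₂, S.add_mem hg₁S hg₂S, hg₁.add hg₂, ?_⟩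
    calc eLpNorm (f₁ + f₂ - (g₁ + g₂)) p μ
        = eLpNorm ((f₁ - g₁) + (f₂ - g₂)) p μ := by rw [add_sub_add_comm]
      _ ≤ eLpNorm (f₁ - g₁) p μ + eLpNorm (f₂ - g₂) p μ :=
        eLpNorm_add_le (hf₁.sub hg₁).1 (hf₂.sub hg₂).1 Fact.out
      _ ≤ ε / 2 + ε / 2 := add_le_add hfg₁ hfg₂
      _ = ε := ENNReal.add_halves ε
  smul_mem' := by
    rintro c f ⟨hf, h⟩
    refine ⟨hf.const_smul c, fun ε hε => ?_⟩
    obtain ⟨δ, hδ, hcδ⟩ := ENNReal.exists_nnreal_pos_mul_lt (enorm_ne_top (x := c)) hε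
    obtain ⟨g, hgS, hg, hfg⟩ := h δ (by simpa using hδ.ne')
    refine ⟨c • g, S.smul_mem c hgS, hg.const_smul c, ?_⟩
    rw [← smul_sub, eLpNorm_const_smul, mul_comm]
    exact (by gcongr : _ ≤ _).trans hcδ.le

theorem mem_lpClosure_of_mem {S : Submodule ℝ (α → F)} {f : α → F} (hfS : f ∈ S)
    (hf : MemLp f p μ) : f ∈ lpClosure p μ S :=
  ⟨hf, fun ε _ => ⟨f, hfS, hf, by simp⟩⟩

theorem mem_lpClosure_of_forall_exists {S : Submodule ℝ (α → F)} {f : α → F} (hf : MemLp f p μ)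
    (h : ∀ ε ≠ 0, ∃ g ∈ lpClosure p μ S, eLpNorm (f - g) p μ ≤ ε) : f ∈ lpClosure p μ S := by
  refine ⟨hf, fun ε hε => ?_⟩
  obtain ⟨g, ⟨hg, hgS⟩, hfg⟩ := h (ε / 2) (ENNReal.half_pos hε).ne'
  obtain ⟨k, hkS, hk, hgk⟩ := hgS (ε / 2) (ENNReal.half_pos hε).ne'
  refine ⟨k, hkS, hk, ?_⟩
  calc eLpNorm (f - k) p μ = eLpNorm ((f - g) + (g - k)) p μ := by rw [sub_add_sub_cancel]
    _ ≤ eLpNorm (f - g) p μ + eLpNorm (g - k) p μ :=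
      eLpNorm_add_le (hf.sub hg).1 (hg.sub hk).1 Fact.out
    _ ≤ ε / 2 + ε / 2 := add_le_add hfg hgk
    _ = ε := ENNReal.add_halves ε

theorem IsLpBounded.map_mem_lpClosure {T : (α → F) →ₗ[ℝ] (β → G)} (hT : IsLpBounded p μ ν T)
    {S : Submodule ℝ (α → F)} {S' : Submodule ℝ (β → G)}
    (hS : ∀ g ∈ S, MemLp g p μ → T g ∈ lpClosure p ν S') {f : α → F} (hf : f ∈ lpClosure p μ S) :
    T f ∈ lpClosure p ν S' := by
  refine mem_lpClosure_of_forall_exists (hT.memLp hf.1) fun ε hε => ?_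
  obtain ⟨K, hK, hTK⟩ := hT
  obtain ⟨δ, hδ, hKδ⟩ := ENNReal.exists_nnreal_pos_mul_lt hK hε
  obtain ⟨g, hgS, hg, hfg⟩ := hf.2 δ (by simpa using hδ.ne')
  refine ⟨T g, hS g hgS hg, ?_⟩
  rw [← map_sub]
  calc eLpNorm (T (f - g)) p ν ≤ K * eLpNorm (f - g) p μ := (hTK _ (hf.1.sub hg)).2
    _ ≤ δ * K := by rw [mul_comm]; gcongr
    _ ≤ ε := hKδ.le

theorem lpClosure_le_lpClosure {S T : Submodule ℝ (α → F)} (h : S ≤ lpClosure p μ T) :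
    lpClosure p μ S ≤ lpClosure p μ T :=
  fun _ hf => IsLpBounded.id.map_mem_lpClosure (fun _ hg _ => h hg) hf

end LpClosure

section TestDerivatives

open Filter Topology

/-- The derivatives of compactly supported `C¹` functions on the line. -/
def testDerivatives : Submodule ℝ (ℝ → ℝ) where
  carrier := {w | ∃ z, ContDiff ℝ 1 z ∧ HasCompactSupport z ∧ deriv z = w}
  zero_mem' := ⟨0, contDiff_const, HasCompactSupport.zero, by ext; simp⟩
  add_mem' := by
    rintro _ _ ⟨z₁, hz₁, hs₁, rfl⟩ ⟨z₂, hz₂, hs₂, rfl⟩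
    refine ⟨z₁ + z₂, hz₁.add hz₂, hs₁.add hs₂, funext fun t => ?_⟩
    exact deriv_add (hz₁.differentiable_one t) (hz₂.differentiable_one t)
  smul_mem' := by
    rintro c _ ⟨z, hz, hs, rfl⟩
    exact ⟨c • z, contDiff_const.smul hz, hs.smul_left, funext fun t =>
      deriv_const_smul c (hz.differentiable_one t)⟩

theorem mem_testDerivatives_of_integral_eq_zero {w : ℝ → ℝ} (hw : Continuous w)
    (hs : HasCompactSupport w) (h0 : ∫ t, w t = 0) : w ∈ testDerivatives := by
  obtain ⟨R, hR⟩ := hs.isCompact.isBounded.subset_ball 0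
  rw [Real.ball_eq_Ioo, zero_sub, zero_add] at hR
  have hsub : Function.support w ⊆ Set.Ioo (-R) R := (subset_tsupport w).trans hR
  have hderiv (t : ℝ) : HasDerivAt (fun t => ∫ s in (-R)..t, w s) (w t) t :=
    (hw.integral_hasStrictDerivAt _ _).hasDerivAt
  have hderiv_eq : deriv (fun t => ∫ s in (-R)..t, w s) = w := funext fun t => (hderiv t).deriv
  refine ⟨_, contDiff_one_iff_deriv.2 ⟨fun t => (hderiv t).differentiableAt, by rwa [hderiv_eq]⟩,
    HasCompactSupport.intro (isCompact_Icc (a := -R) (b := R)) fun t ht => ?_, hderiv_eq⟩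
  rcases lt_or_ge t (-R) with htR | htR
  · refine intervalIntegral.integral_zero_ae (.of_forall fun s hst => ?_)
    rw [Set.uIoc_of_ge htR.le] at hst
    exact Function.notMem_support.1 fun h => (hsub h).1.not_ge hst.2
  · have hRt : R < t := not_le.1 fun htR' => ht ⟨htR, htR'⟩
    rw [intervalIntegral.integral_eq_integral_of_support_subset, h0]
    exact hsub.trans fun s hs => ⟨hs.1, (hs.2.trans hRt).le⟩

theorem eLpNorm_comp_mul_left {F : Type*} [NormedAddCommGroup F] {p : ℝ≥0∞} (hp' : p ≠ ∞)
    {c : ℝ} (hc : c ≠ 0) (h : ℝ → F) :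
    eLpNorm (fun t => h (c * t)) p volume =
      ENNReal.ofReal |c⁻¹| ^ (1 / p).toReal * eLpNorm h p volume := by
  rw [← smul_eq_mul, ← eLpNorm_smul_measure_of_ne_top hp', ← Real.map_volume_mul_left hc,
    (measurableEmbedding_mulLeft₀ hc).eLpNorm_map_measure]
  rfl

theorem tendsto_eLpNorm_dilation {p : ℝ≥0∞} (hp : 1 < p) (hp' : p ≠ ∞) {h : ℝ → ℝ}
    (hh : MemLp h p volume) :
    Tendsto (fun c : ℝ => eLpNorm (fun t => c * h (c * t)) p volume) (𝓝[>] 0) (𝓝 0) := by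
  set q := (1 / p).toReal
  have hq : 0 < 1 - q := by
    have : 1 < p.toReal := by simpa using ENNReal.toReal_strict_mono hp' hp
    rw [sub_pos, show q = 1 / p.toReal by simp [q]]
    exact (div_lt_one (by linarith)).2 this
  have heq : ∀ᶠ c : ℝ in 𝓝[>] 0, ENNReal.ofReal (c ^ (1 - q)) * eLpNorm h p volume =
      eLpNorm (fun t => c * h (c * t)) p volume := by
    filter_upwards [self_mem_nhdsWithin] with c (hc : 0 < c)
    change _ = eLpNorm (c • fun t => h (c * t)) p volume
    rw [eLpNorm_const_smul, eLpNorm_comp_mul_left hp' hc.ne', ← mul_assoc,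
      Real.enorm_of_nonneg hc.le, abs_of_pos (inv_pos.2 hc),
      ENNReal.ofReal_rpow_of_pos (inv_pos.2 hc), ← ENNReal.ofReal_mul hc.le,
      Real.inv_rpow hc.le, Real.rpow_sub hc, Real.rpow_one, div_eq_mul_inv]
  refine Tendsto.congr' heq ?_
  have hpow : Tendsto (fun c : ℝ => c ^ (1 - q)) (𝓝[>] 0) (𝓝 0) := by
    simpa only [Real.zero_rpow hq.ne'] using
      ((Real.continuous_rpow_const hq.le).tendsto 0).mono_left nhdsWithin_le_nhds
  simpa using ENNReal.Tendsto.mul_const (ENNReal.tendsto_ofReal hpow) (.inr hh.2.ne)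

theorem mem_lpClosure_testDerivatives {p : ℝ≥0∞} [Fact (1 ≤ p)] (hp : 1 < p) (hp' : p ≠ ∞)
    {h : ℝ → ℝ} (hh : MemLp h p volume) : h ∈ lpClosure p volume testDerivatives := by
  refine mem_lpClosure_of_forall_exists hh fun ε hε => ?_
  obtain ⟨g, hgs, hhg, hg, hgp⟩ := hh.exists_hasCompactSupport_eLpNorm_sub_le hp' hε
  refine ⟨g, mem_lpClosure_of_forall_exists hgp fun δ hδ => ?_, hhg⟩
  -- `t ↦ c * g (c * t)` has the same integral as `g`, so subtracting it makes the integral vanish.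
  obtain ⟨c, hcδ, hc⟩ := (((tendsto_eLpNorm_dilation hp hp' hgp).eventually_le_const
    (pos_iff_ne_zero.2 hδ)).and self_mem_nhdsWithin).exists
  have hc : 0 < c := hc
  have hdc : Continuous fun t => c * g (c * t) := by fun_prop
  have hds : HasCompactSupport fun t => c * g (c * t) := (hgs.comp_smul hc.ne').mul_left
  refine ⟨fun t => g t - c * g (c * t), mem_lpClosure_of_mem
    (mem_testDerivatives_of_integral_eq_zero (hg.sub hdc) (hgs.sub hds) ?_)
    ((hg.sub hdc).memLp_of_hasCompactSupport (hgs.sub hds)), ?_⟩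
  · rw [integral_sub (hg.integrable_of_hasCompactSupport hgs)
      (hdc.integrable_of_hasCompactSupport hds), integral_const_mul,
      Measure.integral_comp_mul_left, abs_of_pos (inv_pos.2 hc), smul_eq_mul,
      mul_inv_cancel_left₀ hc.ne', sub_self]
  · refine (le_of_eq ?_).trans hcδ
    congr 1
    ext t
    simp

end TestDerivatives

section DifferenceQuotient

open Filter Topology

theorem exists_pos_forall_norm_sub_sub_fderiv_le {E F : Type*} [NormedAddCommGroup E]
    [NormedSpace ℝ E] [NormedAddCommGroup F] [NormedSpace ℝ F] {f : E → F}
    (hf : Differentiable ℝ f) (hf' : UniformContinuous (fderiv ℝ f)) {η : ℝ} (hη : 0 < η) :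
    ∃ δ > 0, ∀ x y, dist y x < δ → ‖f y - f x - fderiv ℝ f x (y - x)‖ ≤ η * ‖y - x‖ := by
  obtain ⟨δ, hδ, hδf⟩ := Metric.uniformContinuous_iff.1 hf' η hη
  refine ⟨δ, hδ, fun x y hxy => ?_⟩
  refine Convex.norm_image_sub_le_of_norm_fderiv_le' (fun u _ => hf u) (fun u hu => ?_)
    (convex_ball x δ) (Metric.mem_ball_self hδ) hxy
  exact dist_eq_norm (fderiv ℝ f u) _ ▸ (hδf hu).le

theorem eventually_forall_abs_mul_lt (C : ℝ) {δ : ℝ} (hδ : 0 < δ) :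
    ∀ᶠ c in 𝓝[>] (0 : ℝ), ∀ s, |s| ≤ C → |c * s| < δ := by
  have hlim : Tendsto (fun c : ℝ => c * C) (𝓝[>] 0) (𝓝 0) := by
    simpa using ((continuous_id.mul_const C).tendsto (0 : ℝ)).mono_left nhdsWithin_le_nhds
  filter_upwards [self_mem_nhdsWithin, hlim.eventually_lt_const hδ] with c (hc : 0 < c) hcC s hs
  rw [abs_mul, abs_of_pos hc]
  exact (mul_le_mul_of_nonneg_left hs hc.le).trans_lt hcC

theorem eventually_forall_abs_mul_deriv_sub_slope_le {z : ℝ → ℝ} (hz : Differentiable ℝ z)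
    (hz' : UniformContinuous (fderiv ℝ z)) (C : ℝ) {η : ℝ} (hη : 0 < η) :
    ∀ᶠ c in 𝓝[>] (0 : ℝ), ∀ t s, |s| ≤ C →
      |s * deriv z t - c⁻¹ * (z (t + c * s) - z t)| ≤ η := by
  obtain ⟨δ, hδ, hδz⟩ := exists_pos_forall_norm_sub_sub_fderiv_le hz hz'
    (div_pos hη (by positivity : 0 < |C| + 1))
  filter_upwards [self_mem_nhdsWithin, eventually_forall_abs_mul_lt C hδ]
    with c (hc : 0 < c) hcδ t s hsC
  have hexp : |z (t + c * s) - z t - c * s * deriv z t| ≤ η / (|C| + 1) * |c * s| := by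
    simpa [fderiv_eq_smul_deriv] using
      hδz t (t + c * s) (by simpa [Real.dist_eq] using hcδ s hsC)
  calc |s * deriv z t - c⁻¹ * (z (t + c * s) - z t)|
      = |-(c⁻¹ * (z (t + c * s) - z t - c * s * deriv z t))| := by
        congr 1
        field_simp
        ring
    _ = c⁻¹ * |z (t + c * s) - z t - c * s * deriv z t| := by
        rw [abs_neg, abs_mul, abs_of_pos (inv_pos.2 hc)]
    _ ≤ c⁻¹ * (η / (|C| + 1) * (c * (|C| + 1))) := by
        refine mul_le_mul_of_nonneg_left (hexp.trans ?_) (inv_pos.2 hc).le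
        rw [abs_mul, abs_of_pos hc]
        gcongr
        linarith [le_abs_self C]
    _ = η := by field_simp

theorem eventually_forall_mul_deriv_sub_slope_eq_zero {z : ℝ → ℝ} (C : ℝ) :
    ∀ᶠ c in 𝓝[>] (0 : ℝ), ∀ t s, |s| ≤ C → t ∉ Metric.cthickening 1 (tsupport z) →
      s * deriv z t - c⁻¹ * (z (t + c * s) - z t) = 0 := by
  filter_upwards [eventually_forall_abs_mul_lt C one_pos] with c hc t s hsC ht
  have hnear : ∀ u, |t - u| ≤ 1 → u ∉ tsupport z := fun u hu hmem =>
    ht (Metric.mem_cthickening_of_dist_le t u 1 _ hmem hu)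
  have ht0 : t ∉ tsupport z := hnear t (by simp)
  have hcs : |t - (t + c * s)| ≤ 1 := by
    rw [sub_add_cancel_left, abs_neg]
    exact (hc s hsC).le
  have hderiv : deriv z t = 0 :=
    image_eq_zero_of_notMem_tsupport fun h => ht0 (tsupport_deriv_subset h)
  rw [hderiv, image_eq_zero_of_notMem_tsupport ht0, image_eq_zero_of_notMem_tsupport (hnear _ hcs),
    mul_zero, sub_self, mul_zero, sub_self]

theorem eventually_forall_abs_mul_deriv_sub_slope_le_indicator {z : ℝ → ℝ} (hz : ContDiff ℝ 1 z)
    (hs : HasCompactSupport z) (C : ℝ) {η : ℝ} (hη : 0 < η) :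
    ∀ᶠ c in 𝓝[>] (0 : ℝ), ∀ t s, |s| ≤ C →
      |s * deriv z t - c⁻¹ * (z (t + c * s) - z t)| ≤
        (Metric.cthickening 1 (tsupport z)).indicator (fun _ => η) t := by
  have hz' : UniformContinuous (fderiv ℝ z) :=
    (hs.fderiv ℝ).uniformContinuous_of_continuous (hz.continuous_fderiv one_ne_zero)
  filter_upwards [eventually_forall_abs_mul_deriv_sub_slope_le hz.differentiable_one hz' C hη,
    eventually_forall_mul_deriv_sub_slope_eq_zero C] with c hle hzero t s hsC
  by_cases ht : t ∈ Metric.cthickening 1 (tsupport z)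
  · exact (Set.indicator_of_mem ht fun _ => η).symm ▸ hle t s hsC
  · rw [Set.indicator_of_notMem ht, hzero t s hsC ht, abs_zero]

end DifferenceQuotient

section Ridge

open Filter Topology

variable {E : Type*} [NormedAddCommGroup E] [InnerProductSpace ℝ E] {p : ℝ≥0∞} {A : Set E}
  {a b : E}

/-- The span of the ridge functions `x ↦ h ⟪a, x⟫` with direction `a` in `A` and profile `h` in
`Lᵖ(ℝ)`. -/
def ridgeSpan (p : ℝ≥0∞) (A : Set E) : Submodule ℝ (E → ℝ) :=
  Submodule.span ℝ {f | ∃ a ∈ A, ∃ h : ℝ → ℝ, MemLp h p volume ∧ f = fun x => h (inner ℝ a x)}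

theorem ridge_mem_ridgeSpan (ha : a ∈ A) {h : ℝ → ℝ} (hh : MemLp h p volume) :
    (fun x => h (inner ℝ a x)) ∈ ridgeSpan p A :=
  Submodule.subset_span ⟨a, ha, h, hh, rfl⟩

variable [MeasurableSpace E] {μ ν : Measure E}

/-- The distribution of `x ↦ ⟪a, x⟫` under `μ` has a bounded density with respect to Lebesgue
measure. -/
def HasBoundedMarginal (μ : Measure E) (a : E) : Prop :=
  ∃ C : ℝ≥0∞, C ≠ ∞ ∧ μ.map (fun x => inner ℝ a x) ≤ C • (volume : Measure ℝ)

variable [BorelSpace E]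

theorem HasBoundedMarginal.mono (hν : HasBoundedMarginal ν a) (h : μ ≤ ν) :
    HasBoundedMarginal μ a := by
  obtain ⟨C, hC, hCν⟩ := hν
  exact ⟨C, hC, (Measure.map_mono h (by fun_prop)).trans hCν⟩

theorem HasBoundedMarginal.measure_preimage_ne_top (hμ : HasBoundedMarginal μ a) {B : Set ℝ}
    (hB : IsCompact B) : μ ((fun x => inner ℝ a x) ⁻¹' B) ≠ ∞ := by
  obtain ⟨C, hC, hCμ⟩ := hμ
  rw [← Measure.map_apply (by fun_prop) hB.measurableSet]
  exact ((hCμ B).trans_lt (ENNReal.mul_lt_top hC.lt_top hB.measure_lt_top)).ne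

theorem HasBoundedMarginal.isFiniteMeasureOnCompacts (hμ : HasBoundedMarginal μ a) :
    IsFiniteMeasureOnCompacts μ where
  lt_top_of_isCompact := fun K hK =>
    (measure_mono (Set.subset_preimage_image (fun x => inner ℝ a x) K)).trans_lt
      (hμ.measure_preimage_ne_top (hK.image (by fun_prop))).lt_top

theorem HasBoundedMarginal.isLpBounded (hμ : HasBoundedMarginal μ a) (hp' : p ≠ ∞) :
    IsLpBounded p volume μ (LinearMap.funLeft ℝ ℝ fun x => inner ℝ a x) := by
  obtain ⟨C, hC, hCμ⟩ := hμ
  refine ⟨C ^ (1 / p).toReal, ENNReal.rpow_ne_top_of_nonneg ENNReal.toReal_nonneg hC,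
    fun h hh => ?_⟩
  have hinner : Measurable fun x : E => inner ℝ a x := by fun_prop
  have hh' : AEStronglyMeasurable h (μ.map fun x => inner ℝ a x) :=
    (hh.1.smul_measure C).mono_measure hCμ
  refine ⟨hh'.comp_measurable hinner, ?_⟩
  calc eLpNorm (h ∘ fun x => inner ℝ a x) p μ = eLpNorm h p (μ.map fun x => inner ℝ a x) :=
        (eLpNorm_map_measure hh' hinner.aemeasurable).symm
    _ ≤ eLpNorm h p (C • volume) := eLpNorm_mono_measure _ hCμ
    _ = C ^ (1 / p).toReal * eLpNorm h p volume := eLpNorm_smul_measure_of_ne_top hp' h C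

theorem isLpBounded_mul_inner {C : ℝ} (hC : ∀ᵐ x ∂μ, |inner ℝ b x| ≤ C) :
    IsLpBounded p μ μ (LinearMap.mulLeft ℝ fun x => inner ℝ b x) :=
  isLpBounded_mulLeft (by fun_prop : Measurable fun x : E => inner ℝ b x).aestronglyMeasurable hC

variable [Fact (1 ≤ p)]

/-- The difference quotients of `x ↦ z ⟪a, x⟫` with respect to `a` are ridge functions, because
`A` is open, and converge to `x ↦ ⟪b, x⟫ * z' ⟪a, x⟫` in `Lᵖ(μ)`. -/
theorem inner_mul_deriv_mem_lpClosure_ridgeSpan (hp' : p ≠ ∞) (hA : IsOpen A)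
    (hμA : ∀ a ∈ A, HasBoundedMarginal μ a) {C : ℝ} (hC : ∀ᵐ x ∂μ, |inner ℝ b x| ≤ C)
    (ha : a ∈ A) {z : ℝ → ℝ} (hz : ContDiff ℝ 1 z) (hs : HasCompactSupport z) :
    (fun x => inner ℝ b x * deriv z (inner ℝ a x)) ∈ lpClosure p μ (ridgeSpan p A) := by
  have hz' : MemLp (deriv z) p volume :=
    (hz.continuous_deriv_one).memLp_of_hasCompactSupport hs.deriv
  have hridge : ∀ a' ∈ A, (fun x => z (inner ℝ a' x)) ∈ lpClosure p μ (ridgeSpan p A) := by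
    intro a' ha'
    have hzp : MemLp z p volume := hz.continuous.memLp_of_hasCompactSupport hs
    exact mem_lpClosure_of_mem (ridge_mem_ridgeSpan ha' hzp)
      (((hμA a' ha').isLpBounded hp').memLp hzp)
  refine mem_lpClosure_of_forall_exists
    (((isLpBounded_mul_inner hC).comp ((hμA a ha).isLpBounded hp')).memLp hz') fun ε hε => ?_
  have hslab : IsCompact (Metric.cthickening 1 (tsupport z)) := hs.isCompact.cthickening
  obtain ⟨η, hη, hηε⟩ := exists_pos_forall_eLpNorm_le (F := ℝ)
    (hslab.measurableSet.preimage (by fun_prop)) ((hμA a ha).measure_preimage_ne_top hslab)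
    (zero_lt_one.trans_le Fact.out).ne' hp' hε
  have hshift : ∀ᶠ c : ℝ in 𝓝[>] 0, a + c • b ∈ A := by
    have : Tendsto (fun c : ℝ => a + c • b) (𝓝 0) (𝓝 a) := by
      simpa using (by fun_prop : Continuous fun c : ℝ => a + c • b).tendsto 0
    exact (this.mono_left nhdsWithin_le_nhds).eventually_mem (hA.mem_nhds ha)
  obtain ⟨c, hcA, hc⟩ := (hshift.and
    (eventually_forall_abs_mul_deriv_sub_slope_le_indicator hz hs C hη)).exists
  refine ⟨c⁻¹ • ((fun x => z (inner ℝ (a + c • b) x)) - fun x => z (inner ℝ a x)),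
    Submodule.smul_mem _ _ (Submodule.sub_mem _ (hridge _ hcA) (hridge a ha)), hηε _ ?_⟩
  filter_upwards [hC] with x hx
  refine le_of_eq_of_le ?_ (hc (inner ℝ a x) (inner ℝ b x) hx)
  simp [inner_add_left, real_inner_smul_left]

theorem inner_mul_mem_lpClosure_ridgeSpan (hp : 1 < p) (hp' : p ≠ ∞) (hA : IsOpen A)
    (hμA : ∀ a ∈ A, HasBoundedMarginal μ a) {C : ℝ} (hC : ∀ᵐ x ∂μ, |inner ℝ b x| ≤ C)
    {f : E → ℝ} (hf : f ∈ lpClosure p μ (ridgeSpan p A)) :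
    (fun x => inner ℝ b x * f x) ∈ lpClosure p μ (ridgeSpan p A) := by
  have hb : IsLpBounded p μ μ (LinearMap.mulLeft ℝ fun x => inner ℝ b x) :=
    isLpBounded_mul_inner hC
  have hspan : ridgeSpan p A ≤
      (lpClosure p μ (ridgeSpan p A)).comap (LinearMap.mulLeft ℝ fun x => inner ℝ b x) := by
    refine Submodule.span_le.2 ?_
    rintro _ ⟨a, ha, h, hh, rfl⟩
    refine (hb.comp ((hμA a ha).isLpBounded hp')).map_mem_lpClosure ?_
      (mem_lpClosure_testDerivatives hp hp' hh)
    rintro _ ⟨z, hz, hs, rfl⟩ -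
    exact inner_mul_deriv_mem_lpClosure_ridgeSpan hp' hA hμA hC ha hz hs
  exact hb.map_mem_lpClosure (fun g hg _ => hspan hg) hf

end Ridge

section Multipliers

variable {E : Type*} [NormedAddCommGroup E] [InnerProductSpace ℝ E] {e : E}

/-- The algebra of continuous functions by which a space of functions may be multiplied. -/
def multiplierAlgebra {X : Type*} [TopologicalSpace X] (W : Submodule ℝ (X → ℝ)) :
    Subalgebra ℝ C(X, ℝ) where
  carrier := {v | ∀ w ∈ W, ⇑v * w ∈ W}
  mul_mem' := by
    intro u v hu hv w hw
    rw [ContinuousMap.coe_mul, mul_assoc]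
    exact hu _ (hv w hw)
  add_mem' := by
    intro u v hu hv w hw
    rw [ContinuousMap.coe_add, add_mul]
    exact W.add_mem (hu w hw) (hv w hw)
  algebraMap_mem' := fun r w hw => W.smul_mem r hw

/-- The largest subspace of `W` that is stable under multiplication by all continuous functions of
`⟪e, x⟫`. It makes the possibly unbounded function `x ↦ ⟪e, x⟫` a multiplier. -/
def ridgeCore (e : E) (W : Submodule ℝ (E → ℝ)) : Submodule ℝ (E → ℝ) :=
  ⨅ ψ : C(ℝ, ℝ), W.comap (LinearMap.mulLeft ℝ fun x => ψ (inner ℝ e x))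

theorem mem_ridgeCore {W : Submodule ℝ (E → ℝ)} {f : E → ℝ} :
    f ∈ ridgeCore e W ↔ ∀ ψ : C(ℝ, ℝ), (fun x => ψ (inner ℝ e x)) * f ∈ W := by
  simp [ridgeCore]

theorem ridgeCore_le (W : Submodule ℝ (E → ℝ)) : ridgeCore e W ≤ W := fun f hf => by
  have hone := mem_ridgeCore.1 hf 1
  rwa [show (fun x => (1 : C(ℝ, ℝ)) (inner ℝ e x)) = 1 from rfl, one_mul] at hone

theorem innerSL_mem_multiplierAlgebra_ridgeCore_self (W : Submodule ℝ (E → ℝ)) :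
    (innerSL ℝ e : C(E, ℝ)) ∈ multiplierAlgebra (ridgeCore e W) := by
  intro w hw
  refine mem_ridgeCore.2 fun ψ => ?_
  rw [← mul_assoc]
  exact mem_ridgeCore.1 hw (ψ * ContinuousMap.id ℝ)

theorem mem_multiplierAlgebra_ridgeCore {W : Submodule ℝ (E → ℝ)} {v : C(E, ℝ)}
    (hv : v ∈ multiplierAlgebra W) : v ∈ multiplierAlgebra (ridgeCore e W) := by
  intro w hw
  refine mem_ridgeCore.2 fun ψ => ?_
  rw [mul_left_comm]
  exact hv _ (mem_ridgeCore.1 hw ψ)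

theorem innerSL_mem_multiplierAlgebra_ridgeCore {W : Submodule ℝ (E → ℝ)}
    (hW : ∀ b ∈ (ℝ ∙ e)ᗮ, (innerSL ℝ b : C(E, ℝ)) ∈ multiplierAlgebra W) (b : E) :
    (innerSL ℝ b : C(E, ℝ)) ∈ multiplierAlgebra (ridgeCore e W) := by
  obtain ⟨u, hu, r, hr, rfl⟩ := (ℝ ∙ e).exists_add_mem_mem_orthogonal b
  obtain ⟨c, rfl⟩ := Submodule.mem_span_singleton.1 hu
  have hsplit : (innerSL ℝ (c • e + r) : C(E, ℝ)) =
      c • (innerSL ℝ e : C(E, ℝ)) + (innerSL ℝ r : C(E, ℝ)) := by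
    ext x
    simp
  rw [hsplit]
  exact Subalgebra.add_mem _
    (Subalgebra.smul_mem _ (innerSL_mem_multiplierAlgebra_ridgeCore_self W) c)
    (mem_multiplierAlgebra_ridgeCore (hW r hr))

theorem separatesPoints_of_innerSL_mem {𝒜 : Subalgebra ℝ C(E, ℝ)}
    (h : ∀ b : E, (innerSL ℝ b : C(E, ℝ)) ∈ 𝒜) : 𝒜.SeparatesPoints := by
  intro x y hxy
  refine ⟨_, ⟨_, h (x - y), rfl⟩, fun heq => hxy ?_⟩
  rw [← sub_eq_zero, ← inner_self_eq_zero (𝕜 := ℝ), inner_sub_right, sub_eq_zero]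
  exact heq

theorem isCompact_setOf_norm_starProjection_le [FiniteDimensional ℝ E] (M : ℝ)
    {B : Set ℝ} (hB : IsCompact B) :
    IsCompact {x : E | ‖(ℝ ∙ e)ᗮ.starProjection x‖ ≤ M ∧ inner ℝ e x ∈ B} := by
  refine ((hB.image (f := fun t => (t / ‖e‖ ^ 2) • e) (by fun_prop)).add
    (isCompact_closedBall (0 : E) M)).of_isClosed_subset ?_ ?_
  · exact (isClosed_le ((ℝ ∙ e)ᗮ.starProjection.continuous.norm) continuous_const).inter
      (hB.isClosed.preimage (innerSL ℝ e).continuous)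
  · rintro x ⟨hx, hxB⟩
    refine ⟨_, ⟨_, hxB, rfl⟩, _, mem_closedBall_zero_iff.2 hx, ?_⟩
    have := (ℝ ∙ e).starProjection_add_starProjection_orthogonal x
    rwa [Submodule.starProjection_singleton] at this

variable [MeasurableSpace E] [BorelSpace E] {p : ℝ≥0∞} [Fact (1 ≤ p)] {μ : Measure E} {A : Set E}

theorem ridge_mem_ridgeCore (hp' : p ≠ ∞) (hμe : HasBoundedMarginal μ e) (he : e ∈ A)
    {h : ℝ → ℝ} (hh : Continuous h) (hs : HasCompactSupport h) :
    (fun x => h (inner ℝ e x)) ∈ ridgeCore e (lpClosure p μ (ridgeSpan p A)) := by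
  refine mem_ridgeCore.2 fun ψ => ?_
  have hψh : MemLp (fun t => ψ t * h t) p volume :=
    (ψ.continuous.mul hh).memLp_of_hasCompactSupport hs.mul_left
  exact mem_lpClosure_of_mem (ridge_mem_ridgeSpan he hψh) ((hμe.isLpBounded hp').memLp hψh)

theorem innerSL_mem_multiplierAlgebra_lpClosure_ridgeSpan [CompleteSpace E] (hp : 1 < p)
    (hp' : p ≠ ∞) (hA : IsOpen A) (hμA : ∀ a ∈ A, HasBoundedMarginal μ a) {M : ℝ}
    (hM : ∀ᵐ x ∂μ, ‖(ℝ ∙ e)ᗮ.starProjection x‖ ≤ M) {b : E} (hb : b ∈ (ℝ ∙ e)ᗮ) :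
    (innerSL ℝ b : C(E, ℝ)) ∈ multiplierAlgebra (lpClosure p μ (ridgeSpan p A)) := by
  intro f hf
  refine inner_mul_mem_lpClosure_ridgeSpan hp hp' hA hμA (C := ‖b‖ * M) ?_ hf
  filter_upwards [hM] with x hx
  calc |inner ℝ b x| = |inner ℝ b ((ℝ ∙ e)ᗮ.starProjection x)| := by
        rw [← Submodule.inner_starProjection_left_eq_right,
          Submodule.starProjection_eq_self_iff.2 hb]
    _ ≤ ‖b‖ * ‖(ℝ ∙ e)ᗮ.starProjection x‖ := abs_real_inner_le_norm _ _
    _ ≤ ‖b‖ * M := by gcongr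

theorem mem_lpClosure_ridgeSpan_of_hasCompactSupport [FiniteDimensional ℝ E] (hp : 1 < p)
    (hp' : p ≠ ∞) (hA : IsOpen A) (hμA : ∀ a ∈ A, HasBoundedMarginal μ a) (he : e ∈ A) {M : ℝ}
    (hM : ∀ᵐ x ∂μ, ‖(ℝ ∙ e)ᗮ.starProjection x‖ ≤ M) {g : E → ℝ} (hg : Continuous g)
    (hgs : HasCompactSupport g) : g ∈ lpClosure p μ (ridgeSpan p A) := by
  have := (hμA e he).isFiniteMeasureOnCompacts
  refine mem_lpClosure_of_forall_exists (hg.memLp_of_hasCompactSupport hgs) fun ε hε => ?_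
  obtain ⟨χ, hχ1, -, hχs, hχ⟩ := exists_continuous_one_zero_of_isCompact
    (hgs.isCompact.image (f := fun x => inner ℝ e x) (by fun_prop)) isClosed_empty
    (Set.disjoint_empty _)
  have hgχ (x : E) : g x * χ (inner ℝ e x) = g x := by
    by_cases hx : x ∈ tsupport g
    · rw [hχ1 ⟨x, hx, rfl⟩, Pi.one_apply, mul_one]
    · rw [image_eq_zero_of_notMem_tsupport hx, zero_mul]
  let K : Set E := {x | ‖(ℝ ∙ e)ᗮ.starProjection x‖ ≤ M ∧ inner ℝ e x ∈ tsupport χ}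
  have hK : IsCompact K := isCompact_setOf_norm_starProjection_le M hχs.isCompact
  obtain ⟨η, hη, hηε⟩ := exists_pos_forall_eLpNorm_le (F := ℝ) (μ := μ) hK.measurableSet
    hK.measure_ne_top (zero_lt_one.trans hp).ne' hp' hε
  set W := lpClosure p μ (ridgeSpan p A)
  have hsep : (multiplierAlgebra (ridgeCore e W)).SeparatesPoints :=
    separatesPoints_of_innerSL_mem <| innerSL_mem_multiplierAlgebra_ridgeCore fun b hb =>
      innerSL_mem_multiplierAlgebra_lpClosure_ridgeSpan hp hp' hA hμA hM hb
  obtain ⟨v, hv, hvg⟩ :=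
    ContinuousMap.exists_mem_subalgebra_near_continuous_of_isCompact_of_separatesPoints
      hsep ⟨g, hg⟩ hK hη
  refine ⟨_, ridgeCore_le W (hv _ (ridge_mem_ridgeCore hp' (hμA e he) he χ.continuous hχs)),
    hηε _ ?_⟩
  filter_upwards [hM] with x hx
  by_cases hxK : x ∈ K
  · rw [Set.indicator_of_mem hxK, Pi.sub_apply, Pi.mul_apply, ← hgχ x, ← sub_mul, norm_mul,
      norm_sub_rev]
    calc ‖v x - g x‖ * ‖χ (inner ℝ e x)‖ ≤ η * 1 := by
          gcongr
          · exact (hvg x hxK).le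
          · exact abs_le.2 ⟨by linarith [(hχ (inner ℝ e x)).1], (hχ _).2⟩
      _ = η := mul_one _
  · have hχ0 : χ (inner ℝ e x) = 0 := image_eq_zero_of_notMem_tsupport fun h => hxK ⟨hx, h⟩
    rw [Set.indicator_of_notMem hxK, Pi.sub_apply, Pi.mul_apply, ← hgχ x, hχ0, mul_zero,
      mul_zero, sub_zero, norm_zero]

theorem mem_lpClosure_ridgeSpan [FiniteDimensional ℝ E] (hp : 1 < p) (hp' : p ≠ ∞)
    (hA : IsOpen A) (hμA : ∀ a ∈ A, HasBoundedMarginal μ a) (he : e ∈ A) {M : ℝ}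
    (hM : ∀ᵐ x ∂μ, ‖(ℝ ∙ e)ᗮ.starProjection x‖ ≤ M) {f : E → ℝ} (hf : MemLp f p μ) :
    f ∈ lpClosure p μ (ridgeSpan p A) := by
  have := (hμA e he).isFiniteMeasureOnCompacts
  refine mem_lpClosure_of_forall_exists hf fun ε hε => ?_
  obtain ⟨g, hgs, hfg, hg, -⟩ := hf.exists_hasCompactSupport_eLpNorm_sub_le hp' hε
  exact ⟨g, mem_lpClosure_ridgeSpan_of_hasCompactSupport hp hp' hA hμA he hM hg hgs, hfg⟩

end Multipliers

section Tube

variable {E : Type*} [NormedAddCommGroup E] [InnerProductSpace ℝ E] {a e : E}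

theorem bijective_inner_prod_orthogonalProjectionOnto (hae : inner ℝ a e ≠ 0) :
    Function.Bijective ((innerSL ℝ a).prod (ℝ ∙ e)ᗮ.orthogonalProjectionOnto) := by
  constructor
  · refine (injective_iff_map_eq_zero _).2 fun x hx => ?_
    obtain ⟨hax, hPx⟩ := Prod.mk_eq_zero.1 hx
    have hxe : x ∈ ℝ ∙ e := by
      rw [← (ℝ ∙ e).orthogonal_orthogonal]
      exact Submodule.orthogonalProjectionOnto_eq_zero_iff.1 hPx
    obtain ⟨c, rfl⟩ := Submodule.mem_span_singleton.1 hxe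
    have hc : c * inner ℝ a e = 0 := by simpa [real_inner_smul_right] using hax
    rw [(mul_eq_zero_iff_right hae).1 hc, zero_smul]
  · rintro ⟨t, y⟩
    refine ⟨y + ((t - inner ℝ a (y : E)) / inner ℝ a e) • e, Prod.ext ?_ ?_⟩
    · simp [inner_add_right, real_inner_smul_right, hae]
    · simp [Submodule.orthogonalProjectionOnto_orthogonalComplement_singleton_eq_zero]

variable [FiniteDimensional ℝ E] [MeasurableSpace E] [BorelSpace E]

/-- The map `x ↦ (⟪a, x⟫, P x)`, with `P` the projection to the complement of `e`, carries `ν` to a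
multiple of a product measure and the tube to a cylinder over a ball. -/
theorem hasBoundedMarginal_restrict_tube (ν : Measure E) [ν.IsAddHaarMeasure]
    (hae : inner ℝ a e ≠ 0) (M : ℝ) :
    HasBoundedMarginal (ν.restrict {x | ‖(ℝ ∙ e)ᗮ.starProjection x‖ ≤ M}) a := by
  let L : E ≃L[ℝ] ℝ × (ℝ ∙ e)ᗮ := (LinearEquiv.ofBijective
    ((innerSL ℝ a).prod (ℝ ∙ e)ᗮ.orthogonalProjectionOnto).toLinearMap
    (bijective_inner_prod_orthogonalProjectionOnto hae)).toContinuousLinearEquiv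
  let κ : Measure (ℝ ∙ e)ᗮ := Measure.addHaar
  obtain ⟨c, hc⟩ : ∃ c : NNReal, ν.map L = c • (volume : Measure ℝ).prod κ :=
    ⟨_, Measure.isAddLeftInvariant_eq_smul (ν.map L) _⟩
  refine ⟨c * κ (Metric.closedBall 0 M),
    ENNReal.mul_ne_top ENNReal.coe_ne_top measure_closedBall_lt_top.ne, Measure.le_iff.2 ?_⟩
  intro B hB
  have hpre : (fun x => inner ℝ a x) ⁻¹' B ∩ {x | ‖(ℝ ∙ e)ᗮ.starProjection x‖ ≤ M} =
      L ⁻¹' (B ×ˢ Metric.closedBall 0 M) := by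
    ext x
    rw [Set.mem_preimage, Set.mem_prod, mem_closedBall_zero_iff]
    rfl
  refine le_of_eq ?_
  calc (ν.restrict {x | ‖(ℝ ∙ e)ᗮ.starProjection x‖ ≤ M}).map (fun x => inner ℝ a x) B
      = ν (L ⁻¹' (B ×ˢ Metric.closedBall 0 M)) := by
        have hinner : Measurable fun x : E => inner ℝ a x := by fun_prop
        rw [Measure.map_apply hinner hB, Measure.restrict_apply (hinner hB), hpre]
    _ = (c • (volume : Measure ℝ).prod κ) (B ×ˢ Metric.closedBall 0 M) := by
        rw [← hc, Measure.map_apply L.continuous.measurable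
          (hB.prod Metric.isClosed_closedBall.measurableSet)]
    _ = ((c * κ (Metric.closedBall 0 M)) • (volume : Measure ℝ)) B := by
        rw [Measure.smul_apply, Measure.prod_prod, Measure.smul_apply, smul_eq_mul,
          ENNReal.smul_def, smul_eq_mul]
        ring

end Tube

section Networks

variable {E : Type*} [NormedAddCommGroup E] [InnerProductSpace ℝ E] {φ : ℝ → ℝ} {p : ℝ≥0∞}
  [Fact (1 ≤ p)]

/-- `𝒮(φ)` as a linear space. -/
def shallowNetworksSubmodule (E : Type*) [NormedAddCommGroup E] [InnerProductSpace ℝ E]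
    (φ : ℝ → ℝ) : Submodule ℝ (E → ℝ) where
  carrier := shallowNetworks E φ
  zero_mem' := ⟨0, Fin.elim0, Fin.elim0, Fin.elim0, by ext; simp⟩
  add_mem' := by
    rintro _ _ ⟨k, y, t, ρ, rfl⟩ ⟨l, y', t', ρ', rfl⟩
    refine ⟨k + l, Fin.append y y', Fin.append t t', Fin.append ρ ρ', ?_⟩
    ext x
    simp [Fin.sum_univ_add]
  smul_mem' := by
    rintro c _ ⟨k, y, t, ρ, rfl⟩
    refine ⟨k, y, fun i => c * t i, ρ, ?_⟩
    ext x
    simp [Finset.mul_sum, mul_assoc]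

theorem comp_inner_mem_shallowNetworksSubmodule (a : E) {F : ℝ → ℝ}
    (hF : F ∈ shallowNetworksSubmodule ℝ φ) :
    (fun x => F (inner ℝ a x)) ∈ shallowNetworksSubmodule E φ := by
  obtain ⟨k, y, t, ρ, rfl⟩ := hF
  refine ⟨k, fun i => y i • a, t, ρ, ?_⟩
  ext x
  simp [real_inner_smul_left, mul_comm]

theorem isUniversalApproximator_iff [MeasureSpace E] {Ω : Set E} :
    IsUniversalApproximator φ p Ω ↔ ∀ f : E → ℝ, MemLp f p (volume.restrict Ω) →
      f ∈ lpClosure p (volume.restrict Ω) (shallowNetworksSubmodule E φ) := by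
  rw [IsUniversalApproximator, Set.eq_univ_iff_forall]
  constructor
  · intro h f hf
    refine ⟨hf, fun ε hε => ?_⟩
    obtain ⟨_, ⟨F, hF, hFp, rfl⟩, hd⟩ :=
      EMetric.mem_closure_iff.1 (h (hf.toLp f)) ε (pos_iff_ne_zero.2 hε)
    rw [Lp.edist_toLp_toLp] at hd
    exact ⟨F, hF, hFp, hd.le⟩
  · intro h f
    refine EMetric.mem_closure_iff.2 fun ε hε => ?_
    obtain ⟨δ, hδ0, hδ⟩ := exists_between hε
    obtain ⟨F, hF, hFp, hd⟩ := (h f (Lp.memLp f)).2 δ hδ0.ne'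
    refine ⟨hFp.toLp F, ⟨F, hF, hFp, rfl⟩, ?_⟩
    rw [← Lp.toLp_coeFn f (Lp.memLp f), Lp.edist_toLp_toLp]
    exact hd.trans_lt hδ

theorem ridgeSpan_le_lpClosure_shallowNetworksSubmodule [MeasurableSpace E] [BorelSpace E]
    {μ : Measure E} {A : Set E} (hp' : p ≠ ∞) (hμA : ∀ a ∈ A, HasBoundedMarginal μ a)
    (hφ : IsUniversalApproximator φ p (Set.univ : Set ℝ)) :
    ridgeSpan p A ≤ lpClosure p μ (shallowNetworksSubmodule E φ) := by
  rw [isUniversalApproximator_iff, Measure.restrict_univ] at hφ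
  refine Submodule.span_le.2 ?_
  rintro _ ⟨a, ha, h, hh, rfl⟩
  have hT := (hμA a ha).isLpBounded hp'
  exact hT.map_mem_lpClosure (fun F hF hFp => mem_lpClosure_of_mem
    (comp_inner_mem_shallowNetworksSubmodule a hF) (hT.memLp hFp)) (hφ h hh)

end Networks

theorem theorem3p1_general {E : Type*} [NormedAddCommGroup E] [InnerProductSpace ℝ E]
    [FiniteDimensional ℝ E] [MeasureSpace E] [BorelSpace E]
    [(volume : Measure E).IsAddHaarMeasure] {p : ℝ≥0∞} [Fact (1 ≤ p)] (hp : 1 < p) (hp' : p < ∞)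
    {Ω : Set E} {e : E} (he : e ≠ 0)
    (hΩ : Bornology.IsBounded ((ℝ ∙ e)ᗮ.starProjection '' Ω)) {φ : ℝ → ℝ}
    (hφ : IsUniversalApproximator φ p (Set.univ : Set ℝ)) : IsUniversalApproximator φ p Ω := by
  obtain ⟨M, hM⟩ := isBounded_iff_forall_norm_le.1 hΩ
  set T : Set E := {x | ‖(ℝ ∙ e)ᗮ.starProjection x‖ ≤ M}
  have hT : MeasurableSet T := measurableSet_le (by fun_prop) measurable_const
  have hΩT : Ω ⊆ T := fun x hx => hM _ ⟨x, hx, rfl⟩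
  let A : Set E := {a | inner ℝ a e ≠ 0}
  have hA : IsOpen A := isOpen_ne_fun (by fun_prop) continuous_const
  have heA : e ∈ A := inner_self_ne_zero.2 he
  have hμA (a : E) (ha : a ∈ A) : HasBoundedMarginal (volume.restrict Ω) a :=
    (hasBoundedMarginal_restrict_tube volume ha M).mono (Measure.restrict_mono hΩT le_rfl)
  have hMae : ∀ᵐ x ∂volume.restrict Ω, ‖(ℝ ∙ e)ᗮ.starProjection x‖ ≤ M :=
    ae_restrict_of_ae_restrict_of_subset hΩT (ae_restrict_mem hT)
  exact isUniversalApproximator_iff.2 fun f hf =>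
    lpClosure_le_lpClosure (ridgeSpan_le_lpClosure_shallowNetworksSubmodule hp'.ne hμA hφ)
      (mem_lpClosure_ridgeSpan hp hp'.ne hA hμA heA hMae hf)

theorem isBounded_starProjection_image_strip (n : ℕ) :
    Bornology.IsBounded
      ((ℝ ∙ EuclideanSpace.single (0 : Fin (n + 1)) (1 : ℝ))ᗮ.starProjection '' strip n) := by
  refine ((isCompact_Icc (a := (0 : Fin (n + 1) → ℝ)) (b := 1)).image
    (PiLp.continuous_toLp 2 _)).isBounded.subset ?_
  rintro _ ⟨x, hx, rfl⟩
  set e : EuclideanSpace ℝ (Fin (n + 1)) := EuclideanSpace.single 0 1 with he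
  have hPx : (ℝ ∙ e)ᗮ.starProjection x = x - x 0 • e := by
    rw [Submodule.starProjection_orthogonal', sub_apply,
      Submodule.starProjection_singleton]
    simp [he, EuclideanSpace.inner_single_left]
  have hcoord (i : Fin (n + 1)) : (x - x 0 • e) i ∈ Set.Icc (0 : ℝ) 1 := by
    cases i using Fin.cases with
    | zero => simp [he]
    | succ j => simpa [he] using hx j
  rw [hPx]
  exact ⟨_, ⟨fun i => (hcoord i).1, fun i => (hcoord i).2⟩, rfl⟩

theorem theorem3p1 (n : ℕ) (p : ℝ≥0∞) [Fact (1 ≤ p)] (hp : 2 ≤ p) (hp' : p < ∞)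
    (φ : ℝ → ℝ)
    (hφ : IsUniversalApproximator φ p (Set.univ : Set ℝ)) :
    IsUniversalApproximator φ p (strip n) :=
  theorem3p1_general (ENNReal.one_lt_two.trans_le hp) hp' (by simp)
    (isBounded_starProjection_image_strip n) hφ
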